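/- Let $\mathscr{A}$ be an abelian category with enough projective objects and let $Q=(Q_0,Q_1)$ be a finite acyclic quiver (finitely many vertices and arrows, no oriented cycles). Subcategories are full. A subcategory is *additively closed* if it is closed under finite direct sums and direct summands, and $\mathrm{add}(\mathcal S)$ is the subcategory of all direct summands of finite direct sums of objects of $\mathcal S$. For an integer $n\ge 0$, an additively closed subcategory $\mathscr{T}$ of an abelian category $\mathscr{B}$ with enough projective objects is called *$n$-tilting* if (i) $\mathscr{T}$ is contravariantly finite: for every object $B$ of $\mathscr{B}$ there is a morphism $\varphi\colon X\to B$ with $X\in\mathscr{T}$ such that every morphism from an object of $\mathscr{T}$ to $B$ factors through $\varphi$; (ii) $\mathrm{Ext}^i_{\mathscr{B}}(T_1,T_2)=0$ for all $T_1,T_2\in\mathscr{T}$ and all $i\ge 1$; (iii) every object of $\mathscr{T}$ has projective dimension at most $n$; (iv) for every projective object $P$ of $\mathscr{B}$ there is an exact sequence $0\to P\to T^0\to T^1\to\cdots\to T^n\to 0$ with all $T^i\in\mathscr{T}$. Let $\mathrm{Rep}(Q,\mathscr{A})$ be the category of representations of $Q$ in $\mathscr{A}$. For $i\in Q_0$ let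 $e_i^{\rho}\colon\mathscr{A}\to\mathrm{Rep}(Q,\mathscr{A})$ be the right adjoint of the evaluation functor $X\mapsto X_i$; explicitly $e_i^{\rho}(M)_j=\bigoplus_{Q(j,i)}M$, where $Q(j,i)$ is the set of paths from $j$ to $i$, and the arrows act by the natural projections. Then the abelian category $\mathrm{Rep}(Q,\mathscr{A})$ has enough projective objects, and for every $n\ge 0$ and every $n$-tilting subcategory $\mathscr{T}$ of $\mathscr{A}$ the subcategory $$\mathscr{T}'=\mathrm{add}\{\,e_i^{\rho}(T) : i\in Q_0,\ T\in\mathscr{T}\,\}$$ is an $(n+1)$-tilting subcategory of $\mathrm{Rep}(Q,\mathscr{A})$. The case $n=0$ is the following: the subcategory $\mathrm{Prj}(\mathscr{A})$ of all projective objects is the unique $0$-tilting subcategory of $\mathscr{A}$ (among subcategories closed under isomorphism), and $\mathrm{add}\{\,e_i^{\rho}(P) : i\in Q_0,\ P\in\mathrm{Prj}(\mathscr{A})\,\}$ is a $1$-tilting subcategory of $\mathrm{Rep}(Q,\mathscr{A})$. -/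

import Mathlib

open CategoryTheory CategoryTheory.Limits CategoryTheory.Abelian

universe v u v₁ u₁

namespace QuiverTilting

section Subcategories

/-! Full subcategories of a category are given by predicates on objects
(`ObjectProperty`). -/

/-- `T` is contravariantly finite: every object `A` has a right `T`-approximation, that is, a
morphism `φ : X ⟶ A` with `X` in `T` through which every morphism from an object of `T` to `A`
factors. -/
def IsContravariantlyFinite {C : Type u} [Category.{v} C] (T : ObjectProperty C) : Prop :=
  ∀ A : C, ∃ (X : C) (φ : X ⟶ A), T X ∧
    ∀ (X' : C), T X' → ∀ g : X' ⟶ A, ∃ h : X' ⟶ X, h ≫ φ = g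

/-- `T` is additively closed: it is closed under finite direct sums (including the empty one) and
under direct summands. In an abelian category the direct summands of an object are its retracts,
and finite direct sums are finite products. -/
structure IsAdditivelyClosed {C : Type u} [Category.{v} C] (T : ObjectProperty C) : Prop where
  finite_sums : T.IsClosedUnderFiniteProducts
  summands : T.IsStableUnderRetracts

variable {C : Type u} [Category.{v} C] [Abelian C]

/-- `add S`: the direct summands of finite direct sums of objects of `S`. -/
def addClosure (S : ObjectProperty C) : ObjectProperty C := fun X =>
  haveI : HasFiniteBiproducts C := Abelian.hasFiniteBiproducts
  ∃ (k : ℕ) (F : Fin k → C), (∀ i, S (F i)) ∧ Nonempty (Retract X (⨁ F))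

/-- There is an exact sequence `0 ⟶ P ⟶ T⁰ ⟶ T¹ ⟶ ⋯ ⟶ Tⁿ ⟶ 0` with all `Tⁱ` in `T`. The sequence
is `E`, whose `n + 4` objects are numbered from `0` to `n + 3`; so `Tⁱ` has number `i + 2`. -/
def HasCoresolution (T : ObjectProperty C) (n : ℕ) (P : C) : Prop :=
  ∃ E : ComposableArrows C (n + 3), E.Exact ∧
    IsZero (E.obj 0) ∧ Nonempty (E.obj 1 ≅ P) ∧
    (∀ i : Fin (n + 4), 2 ≤ i.val → i.val ≤ n + 2 → T (E.obj i)) ∧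
    IsZero (E.obj (Fin.last (n + 3)))

/-- `T` is an `n`-tilting subcategory of the abelian category `C` (meant for `C` with enough
projective objects). The `Ext`-groups are those of the abelian category `C`, taken in the universe
in which they always exist. -/
structure IsTilting (n : ℕ) (T : ObjectProperty C) : Prop where
  additively_closed : IsAdditivelyClosed T
  contravariantly_finite : IsContravariantlyFinite T
  ext_vanishing : ∀ T₁ T₂ : C, T T₁ → T T₂ → ∀ i : ℕ, 1 ≤ i →
    letI := HasExt.standard C
    Subsingleton (Ext.{max u v} T₁ T₂ i)
  projective_dimension : ∀ X : C, T X → HasProjectiveDimensionLE X n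
  coresolution : ∀ P : C, Projective P → HasCoresolution T n P

end Subcategories

section Quivers

/-- The quiver `Q` has no oriented cycles: every path from a vertex to itself is trivial. -/
class IsAcyclicQuiver (Q : Type u₁) [Quiver.{v₁} Q] : Prop where
  eq_nil : ∀ (i : Q) (p : Quiver.Path i i), p = Quiver.Path.nil

/-- In a finite acyclic quiver there are only finitely many paths between two vertices. -/
theorem finite_path (Q : Type u₁) [Quiver.{v₁} Q] [Finite Q] [∀ i j : Q, Finite (i ⟶ j)]
    [IsAcyclicQuiver Q] (i j : Q) : Finite (Quiver.Path i j) := by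
  let r : Q → Q → Prop := fun a b => ∃ p : Quiver.Path a b, 0 < p.length
  have hirr : Std.Irrefl r := ⟨by
    rintro a ⟨p, hp⟩
    rw [IsAcyclicQuiver.eq_nil a p] at hp
    simp at hp⟩
  have htr : IsTrans Q r := ⟨by
    rintro a b c ⟨p, hp⟩ ⟨q, hq⟩
    exact ⟨p.comp q, by rw [Quiver.Path.length_comp]; omega⟩⟩
  have hwf : WellFounded r := Finite.wellFounded_of_trans_of_irrefl r
  induction j using hwf.induction with
  | _ j ih =>
    have : ∀ k : { k : Q // r k j }, Finite (Quiver.Path i k.1) := fun k => ih k.1 k.2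
    let f : Option (Σ k : { k : Q // r k j }, Quiver.Path i k.1 × (k.1 ⟶ j)) →
        Set (Quiver.Path i j) := fun x =>
      match x with
      | none => { p | p.length = 0 }
      | some ⟨_, p, a⟩ => {p.cons a}
    have hfin : ∀ x, (f x).Finite := by
      rintro (_ | ⟨k, p, a⟩)
      · refine Set.Subsingleton.finite ?_
        intro p hp q hq
        cases p with
        | nil => exact (IsAcyclicQuiver.eq_nil _ q).symm
        | cons p a => simp [f] at hp
      · exact Set.finite_singleton _
    refine Set.finite_univ_iff.mp ((Set.finite_iUnion hfin).subset ?_)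
    intro p _
    rw [Set.mem_iUnion]
    cases p with
    | nil => exact ⟨none, rfl⟩
    | cons p a => exact ⟨some ⟨⟨_, ⟨a.toPath, by simp⟩⟩, p, a⟩, rfl⟩

/-- `Rep(Q, A)`: the category of representations of the quiver `Q` in `A`, as the category of
functors from the path category of `Q` to `A`. Since the path category is free on `Q`, a functor is
the same as a family of objects indexed by the vertices with a morphism for every arrow, and a
natural transformation is the same as a family of morphisms compatible with the arrows. -/
abbrev QuiverRep (Q : Type u₁) [Quiver.{v₁} Q] (A : Type u) [Category.{v} A] :=
  Paths Q ⥤ A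

/-- The evaluation functor `e_i : Rep(Q, A) ⥤ A`, `X ↦ X_i`. -/
abbrev eval (Q : Type u₁) [Quiver.{v₁} Q] (A : Type u) [Category.{v} A] (i : Q) :
    QuiverRep Q A ⥤ A :=
  (evaluation (Paths Q) A).obj i

variable (Q : Type u₁) [Quiver.{v₁} Q] [Finite Q] [∀ i j : Q, Finite (i ⟶ j)] [IsAcyclicQuiver Q]
  (A : Type u) [Category.{v} A] [Abelian A]

instance hasProductsOfShape_paths (i j : Paths Q) : HasProductsOfShape (i ⟶ j) A := by
  have : Finite (i ⟶ j) := finite_path Q i j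
  infer_instance

/-- The right adjoint `e_i^ρ : A ⥤ Rep(Q, A)` of `e_i`. At the vertex `j` it is the (finite) product
of copies of the given object indexed by the paths from `j` to `i`, and an arrow `j ⟶ k` acts by the
projection along composition of paths with that arrow. -/
noncomputable def eRho (i : Q) : A ⥤ QuiverRep Q A :=
  evaluationRightAdjoint A (C := Paths Q) i

/-- `e_i^ρ` is indeed right adjoint to `e_i`. -/
noncomputable def evalAdjERho (i : Q) : eval Q A i ⊣ eRho Q A i :=
  evaluationAdjunctionLeft A (C := Paths Q) i

/-- The representations `e_i^ρ(M)`, for `i` a vertex of `Q` and `M` in `T`. -/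
def eRhoObjects (T : ObjectProperty A) : ObjectProperty (QuiverRep Q A) := fun X =>
  ∃ (i : Q) (M : A), T M ∧ X = (eRho Q A i).obj M

end Quivers

end QuiverTilting

open QuiverTilting

/-! Finiteness and acyclicity leave finitely many paths between two vertices, so each value of
`e_i^ρ(M)` is a finite direct sum of copies of `M`. Hence `e_i^ρ` is exact and objects of `T'` have
all their values in `T`. Evaluation is exact and, as `e_i^ρ` preserves epimorphisms, keeps
projectives projective; so `Ext^k(X_i, M) = 0` forces `Ext^k(X, e_i^ρ M) = 0` for `k ≥ 1`
(`ExtVanishes.of_adjunction`). This gives the vanishing of `Ext` on `T'`.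

The other main ingredient is the short exact sequence `0 ⟶ Y ⟶ ⨁ e_i^ρ(Y_i) ⟶ ⨁ e_i^ρ(Y_j) ⟶ 0`,
summed over vertices `i` and arrows `i ⟶ j` (`shortExact_cofree`). Used in the second variable of
`Ext`, it bounds projective dimension by one more than that of the values. For `Y = P` projective,
the `P_i` are projective and have coresolutions of length `n` by `T`. Applying `e_i^ρ` coresolves
the last two terms, and `IsCoresolved.of_shortExact` combines these into a coresolution of `P` of
length `n + 1`.

For contravariant finiteness, maps `e_c^ρ(M) ⟶ X` are parametrized by maps from `M` to one object
`G` (`exists_coev_counit`), and a `T`-approximation of `G` is transported by `e_c^ρ`. -/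

namespace QuiverTilting

section General

universe v₂ u₂

variable {C : Type u} [Category.{v} C] [Abelian C]

/-! ### Decompositions of identity morphisms -/

/-- Being a summand of a finite sum amounts to a decomposition `∑ p_j q_j = 𝟙`. This form needs no
chosen biproduct and survives evaluation at a vertex. -/
lemma addClosure_of_sum_eq_id {S : ObjectProperty C} {J : Type*} [Fintype J] {X : C} (F : J → C)
    (hF : ∀ j, S (F j)) (p : ∀ j, X ⟶ F j) (q : ∀ j, F j ⟶ X) (h : ∑ j, p j ≫ q j = 𝟙 X) :
    addClosure S X := by
  let e := Fintype.equivFin J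
  have : HasFiniteBiproducts C := Abelian.hasFiniteBiproducts
  refine ⟨Fintype.card J, fun i => F (e.symm i), fun i => hF _,
    ⟨⟨biproduct.lift fun i => p _, biproduct.desc fun i => q _, ?_⟩⟩⟩
  rw [biproduct.lift_desc, ← h]
  exact e.symm.sum_comp fun j => p j ≫ q j

lemma addClosure.exists_sum_eq_id {S : ObjectProperty C} {X : C} (h : addClosure S X) :
    ∃ (k : ℕ) (F : Fin k → C) (p : ∀ j, X ⟶ F j) (q : ∀ j, F j ⟶ X),
      (∀ j, S (F j)) ∧ ∑ j, p j ≫ q j = 𝟙 X := by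
  have : HasFiniteBiproducts C := Abelian.hasFiniteBiproducts
  obtain ⟨k, F, hF, ⟨r⟩⟩ := h
  refine ⟨k, F, fun j => r.i ≫ biproduct.π F j, fun j => biproduct.ι F j ≫ r.r, hF, ?_⟩
  have := biproduct.total (f := F)
  calc ∑ j, (r.i ≫ biproduct.π F j) ≫ biproduct.ι F j ≫ r.r
      = r.i ≫ (∑ j, biproduct.π F j ≫ biproduct.ι F j) ≫ r.r := by
        simp only [Preadditive.sum_comp, Preadditive.comp_sum, Category.assoc]
    _ = 𝟙 X := by rw [this, Category.id_comp, r.retract]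

lemma addClosure_of_mem {S : ObjectProperty C} {X : C} (h : S X) : addClosure S X :=
  addClosure_of_sum_eq_id (J := Unit) (fun _ => X) (fun _ => h) (fun _ => 𝟙 X) (fun _ => 𝟙 X)
    (by simp)

lemma IsAdditivelyClosed.of_sum_eq_id {T : ObjectProperty C} (hT : IsAdditivelyClosed T)
    {J : Type*} [Fintype J] {X : C} (F : J → C)
    (hF : ∀ j, T (F j)) (p : ∀ j, X ⟶ F j) (q : ∀ j, F j ⟶ X) (h : ∑ j, p j ≫ q j = 𝟙 X) :
    T X := by
  have := hT.finite_sums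
  have := hT.summands
  have : HasFiniteBiproducts C := Abelian.hasFiniteBiproducts
  let e := Fintype.equivFin J
  have hP : T (⨁ fun i => F (e.symm i)) :=
    T.prop_of_isLimit_fan (biproduct.isLimit _) fun i => hF _
  refine T.prop_of_retract
    ⟨biproduct.lift fun i => p _, biproduct.desc fun i => q _, ?_⟩ hP
  rw [biproduct.lift_desc, ← h]
  exact e.symm.sum_comp fun j => p j ≫ q j

lemma IsAdditivelyClosed.biprod {T : ObjectProperty C} (hT : IsAdditivelyClosed T) {X Y : C}
    (hX : T X) (hY : T Y) : T (X ⊞ Y) := by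
  refine hT.of_sum_eq_id (J := WalkingPair) (fun j => WalkingPair.rec X Y j)
    (by rintro (_ | _) <;> assumption)
    (WalkingPair.rec biprod.fst biprod.snd) (WalkingPair.rec biprod.inl biprod.inr) ?_
  rw [Fintype.sum_eq_add WalkingPair.left WalkingPair.right (by simp)
    (by rintro (_ | _) <;> simp)]
  exact biprod.total

lemma IsAdditivelyClosed.of_iso {C : Type u} [Category.{v} C] {T : ObjectProperty C}
    (hT : IsAdditivelyClosed T) {X Y : C}
    (e : X ≅ Y) (hX : T X) : T Y :=
  have := hT.summands
  T.prop_of_retract e.symm.retract hX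

lemma isAdditivelyClosed_of_sum_eq_id {T : ObjectProperty C}
    (h : ∀ (J : Type) [Fintype J] (X : C) (F : J → C) (_ : ∀ j, T (F j)) (p : ∀ j, X ⟶ F j)
      (q : ∀ j, F j ⟶ X), ∑ j, p j ≫ q j = 𝟙 X → T X) : IsAdditivelyClosed T where
  finite_sums := ⟨fun J _ => ⟨by
    rintro X ⟨P⟩
    have := Fintype.ofFinite J
    have : HasFiniteBiproducts C := Abelian.hasFiniteBiproducts
    let F : J → C := fun j => P.diag.obj ⟨j⟩
    let e : X ≅ ⨁ F := P.isLimit.conePointsIsoOfNatIso (biproduct.isLimit F)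
      (Discrete.natIso fun _ => Iso.refl _)
    refine h J X F (fun j => P.prop_diag_obj ⟨j⟩) (fun j => e.hom ≫ biproduct.π F j)
      (fun j => biproduct.ι F j ≫ e.inv) ?_
    calc ∑ j, (e.hom ≫ biproduct.π F j) ≫ biproduct.ι F j ≫ e.inv
        = e.hom ≫ (∑ j, biproduct.π F j ≫ biproduct.ι F j) ≫ e.inv := by
          simp only [Preadditive.sum_comp, Preadditive.comp_sum, Category.assoc]
      _ = 𝟙 X := by rw [biproduct.total, Category.id_comp, e.hom_inv_id]⟩⟩
  summands := ⟨fun {X Y} r hY => h Unit X (fun _ => Y) (fun _ => hY) (fun _ => r.i) (fun _ => r.r)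
    (by simp)⟩

lemma isAdditivelyClosed_addClosure (S : ObjectProperty C) :
    IsAdditivelyClosed (addClosure S) := by
  refine isAdditivelyClosed_of_sum_eq_id fun J _ X F hF p q h => ?_
  choose k G p' q' hG hpq using fun j => (hF j).exists_sum_eq_id
  refine addClosure_of_sum_eq_id (J := Σ j, Fin (k j)) (fun x => G x.1 x.2) (fun x => hG _ _)
    (fun x => p x.1 ≫ p' x.1 x.2) (fun x => q' x.1 x.2 ≫ q x.1) ?_
  rw [Fintype.sum_sigma, ← h]
  refine Finset.sum_congr rfl fun j _ => ?_
  calc ∑ y, (p j ≫ p' j y) ≫ q' j y ≫ q j = p j ≫ (∑ y, p' j y ≫ q' j y) ≫ q j := by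
        simp only [Preadditive.sum_comp, Preadditive.comp_sum, Category.assoc]
    _ = p j ≫ q j := by rw [hpq, Category.id_comp]

/-! ### Vanishing of `Ext` -/

/-- The group `Ext^k(X, Y)` vanishes. -/
def ExtVanishes (X Y : C) (k : ℕ) : Prop :=
  letI := HasExt.standard C
  Subsingleton (Ext.{max u v} X Y k)

lemma extVanishes_iff (X Y : C) (k : ℕ) :
    letI := HasExt.standard C
    ExtVanishes X Y k ↔ ∀ x : Ext.{max u v} X Y k, x = 0 :=
  letI := HasExt.standard C
  subsingleton_iff_forall_eq 0

lemma extVanishes_of_projective (P Y : C) [Projective P] (k : ℕ) : ExtVanishes P Y (k + 1) := by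
  let := HasExt.standard C
  rw [extVanishes_iff]
  exact fun x => x.eq_zero_of_projective

lemma ExtVanishes.of_sum_eq_id {J : Type*} [Fintype J] {X Y : C} (F : J → C) {k : ℕ}
    (hF : ∀ j, ExtVanishes X (F j) k) (p : ∀ j, Y ⟶ F j) (q : ∀ j, F j ⟶ Y)
    (h : ∑ j, p j ≫ q j = 𝟙 Y) : ExtVanishes X Y k := by
  let := HasExt.standard C
  rw [extVanishes_iff]
  intro x
  rw [← x.comp_mk₀_id, ← h, Ext.mk₀_sum, Ext.comp_sum]
  refine Finset.sum_eq_zero fun j _ => ?_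
  rw [← Ext.mk₀_comp_mk₀, ← Ext.comp_assoc_of_third_deg_zero,
    (extVanishes_iff _ _ _).1 (hF j) (x.comp (Ext.mk₀ (p j)) (add_zero k)), Ext.zero_comp]

lemma ExtVanishes.of_shortExact_left {S : ShortComplex C} (hS : S.ShortExact) {Y : C} {k : ℕ}
    (h₂ : ExtVanishes S.X₂ Y k) (h₃ : ExtVanishes S.X₃ Y (k + 1)) : ExtVanishes S.X₁ Y k := by
  let := HasExt.standard C
  rw [extVanishes_iff] at *
  intro x
  obtain ⟨y, rfl⟩ := Ext.contravariant_sequence_exact₁ hS Y x (add_comm 1 k) (h₃ _)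
  rw [h₂ y, Ext.comp_zero]

lemma ExtVanishes.of_shortExact_right {S : ShortComplex C} (hS : S.ShortExact) {X : C} {k : ℕ}
    (h₂ : ExtVanishes X S.X₂ (k + 1)) (h₃ : ExtVanishes X S.X₃ k) :
    ExtVanishes X S.X₁ (k + 1) := by
  let := HasExt.standard C
  rw [extVanishes_iff] at *
  intro x
  obtain ⟨y, rfl⟩ := Ext.covariant_sequence_exact₁ X hS x (h₂ _) rfl
  rw [h₃ y, Ext.zero_comp]

lemma ExtVanishes.of_shortExact_quotient {S : ShortComplex C} (hS : S.ShortExact) {Y : C} {k : ℕ}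
    (h₁ : ExtVanishes S.X₁ Y k) (h₂ : ExtVanishes S.X₂ Y (k + 1)) :
    ExtVanishes S.X₃ Y (k + 1) := by
  let := HasExt.standard C
  rw [extVanishes_iff] at *
  intro x
  obtain ⟨y, rfl⟩ := Ext.contravariant_sequence_exact₃ hS Y x (h₂ _) (add_comm 1 k)
  rw [h₁ y, Ext.comp_zero]

lemma ExtVanishes.exists_extension {S : ShortComplex C} (hS : S.ShortExact) {Y : C}
    (h : ExtVanishes S.X₃ Y 1) (f : S.X₁ ⟶ Y) : ∃ g : S.X₂ ⟶ Y, S.f ≫ g = f := by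
  let := HasExt.standard C
  rw [extVanishes_iff] at h
  obtain ⟨y, hy⟩ := Ext.contravariant_sequence_exact₁ hS Y (Ext.mk₀ f) (add_zero 1) (h _)
  obtain ⟨g, rfl⟩ := (Ext.mk₀_bijective _ _).2 y
  rw [Ext.mk₀_comp_mk₀] at hy
  exact ⟨g, (Ext.mk₀_bijective _ _).1 hy⟩

/-- As `S.X₂` is projective, every class in `Ext^1(S.X₃, Y)` is the pushout of the class of `S`
along some `f`; it vanishes once `f` extends to `S.X₂`. -/
lemma extVanishes_one_of_extensions {S : ShortComplex C} (hS : S.ShortExact) [Projective S.X₂]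
    {Y : C} (h : ∀ f : S.X₁ ⟶ Y, ∃ g : S.X₂ ⟶ Y, S.f ≫ g = f) : ExtVanishes S.X₃ Y 1 := by
  let := HasExt.standard C
  rw [extVanishes_iff]
  intro x
  obtain ⟨y, rfl⟩ := Ext.contravariant_sequence_exact₃ hS Y x
    ((extVanishes_iff _ _ _).1 (extVanishes_of_projective S.X₂ Y 0) _) (add_zero 1)
  obtain ⟨f, rfl⟩ := (Ext.mk₀_bijective _ _).2 y
  obtain ⟨g, rfl⟩ := h f
  rw [← Ext.mk₀_comp_mk₀, ← Ext.comp_assoc _ _ _ (add_zero 1) (add_zero 0) (by simp),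
    hS.extClass_comp, Ext.zero_comp]

lemma hasProjectiveDimensionLE_iff_extVanishes (X : C) (n : ℕ) :
    HasProjectiveDimensionLE X n ↔ ∀ (k : ℕ) (Y : C), n ≤ k → ExtVanishes X Y (k + 1) := by
  constructor
  · intro h k Y hk
    exact h.subsingleton' (k + 1) (by omega) (Y := Y)
  · intro h
    refine ⟨fun i hi Y => ?_⟩
    obtain ⟨k, rfl⟩ : ∃ k, i = k + 1 := ⟨i - 1, by omega⟩
    exact h k Y (by omega)

/-- A left adjoint preserving monomorphisms and projective objects detects vanishing of `Ext`
with coefficients in the image of the right adjoint. -/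
lemma ExtVanishes.of_adjunction {D : Type u₂} [Category.{v₂} D] [Abelian D]
    [EnoughProjectives C] {F : C ⥤ D} {G : D ⥤ C} (adj : F ⊣ G)
    [PreservesFiniteLimits F] [PreservesFiniteColimits F] [F.PreservesProjectiveObjects] {Y : D}
    (k : ℕ) : ∀ X : C, ExtVanishes (F.obj X) Y (k + 1) → ExtVanishes X (G.obj Y) (k + 1) := by
  have key (X : C) : ∃ S : ShortComplex C, S.ShortExact ∧ Projective S.X₂ ∧ S.X₃ = X := by
    refine ⟨ShortComplex.mk (kernel.ι (Projective.π X)) (Projective.π X) (kernel.condition _),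
      ⟨ShortComplex.kernelSequence_exact (Projective.π X)⟩, ?_, rfl⟩
    dsimp
    infer_instance
  induction k with
  | zero =>
    intro X hX
    obtain ⟨S, hS, _, rfl⟩ := key X
    -- Transpose `f`, extend it over `F.obj S.X₂` by the vanishing hypothesis, and transpose back.
    refine extVanishes_one_of_extensions hS fun f => ?_
    obtain ⟨g, hg⟩ := ExtVanishes.exists_extension (hS.map_of_exact F) hX
      ((adj.homEquiv _ _).symm f)
    refine ⟨adj.homEquiv _ _ g, (adj.homEquiv_naturality_left S.f g).symm.trans ?_⟩
    rw [← Equiv.eq_symm_apply]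
    exact hg
  | succ k ih =>
    intro X hX
    obtain ⟨S, hS, _, rfl⟩ := key X
    -- Dimension shift on both sides of the adjunction: `S.X₂` and its image under `F` are
    -- projective.
    refine ExtVanishes.of_shortExact_quotient hS (ih _ ?_) (extVanishes_of_projective _ _ _)
    have : Projective (F.obj S.X₂) := F.projective_obj_of_projective inferInstance
    exact ExtVanishes.of_shortExact_left (hS.map_of_exact F)
      (extVanishes_of_projective (F.obj S.X₂) Y k) hX

end General

/-! ### Finite coresolutions as iterated short exact sequences -/

section Coresolutions

universe v₂ u₂

variable {C : Type u} [Category.{v} C] [Abelian C]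

lemma shortExact_of_desc {S : ShortComplex C} [Mono S.f] [Epi S.g]
    (h : ∀ (W : C) (k : S.X₂ ⟶ W), S.f ≫ k = 0 → ∃ m : S.X₃ ⟶ W, S.g ≫ m = k) : S.ShortExact where
  exact := by
    refine S.exact_of_g_is_cokernel (CokernelCofork.IsColimit.ofπ' S.g S.zero fun {W} k hk => ?_)
    exact ⟨(h W k hk).choose, (h W k hk).choose_spec⟩

lemma shortExact_of_lift {S : ShortComplex C} [Mono S.f] [Epi S.g]
    (h : ∀ (W : C) (k : W ⟶ S.X₂), k ≫ S.g = 0 → ∃ m : W ⟶ S.X₁, m ≫ S.f = k) : S.ShortExact where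
  exact := by
    refine S.exact_of_f_is_kernel (KernelFork.IsLimit.ofι' S.f S.zero fun {W} k hk => ?_)
    exact ⟨(h W k hk).choose, (h W k hk).choose_spec⟩

/-- There is an exact sequence `0 ⟶ X ⟶ T⁰ ⟶ ⋯ ⟶ Tⁿ ⟶ 0` with all `Tⁱ` in `T`, in terms of its
decomposition into short exact sequences. -/
def IsCoresolved (T : ObjectProperty C) : ℕ → C → Prop
  | 0, X => T X
  | n + 1, X => ∃ (Y Z : C) (f : X ⟶ Y) (g : Y ⟶ Z) (w : f ≫ g = 0),
      (ShortComplex.mk f g w).ShortExact ∧ T Y ∧ IsCoresolved T n Z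

namespace IsCoresolved

variable {T : ObjectProperty C} (hT : IsAdditivelyClosed T)

include hT in
lemma of_iso {n : ℕ} {X X' : C} (e : X ≅ X') (h : IsCoresolved T n X) : IsCoresolved T n X' := by
  cases n with
  | zero => exact hT.of_iso e h
  | succ n =>
    obtain ⟨Y, Z, f, g, w, hS, hY, hZ⟩ := h
    refine ⟨Y, Z, e.inv ≫ f, g, by simp [w], ?_, hY, hZ⟩
    refine ShortComplex.shortExact_of_iso (S₁ := ShortComplex.mk f g w) ?_ hS
    exact ShortComplex.isoMk e (Iso.refl _) (Iso.refl _) (by simp) (by simp)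

include hT in
lemma biprod_of_mem {n : ℕ} {R X : C} (hR : T R) (h : IsCoresolved T n X) :
    IsCoresolved T n (R ⊞ X) := by
  cases n with
  | zero => exact hT.biprod hR h
  | succ n =>
    obtain ⟨Y, Z, f, g, w, hS, hY, hZ⟩ := h
    have := hS.mono_f
    have := hS.epi_g
    refine ⟨R ⊞ Y, Z, biprod.map (𝟙 R) f, biprod.snd ≫ g, by simp [w], ?_, hT.biprod hR hY, hZ⟩
    have : Mono (biprod.map (𝟙 R) f) := inferInstance
    have : Epi ((biprod.snd : R ⊞ Y ⟶ Y) ≫ g) := epi_comp _ _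
    refine shortExact_of_lift (S := ShortComplex.mk _ _ _) fun W k hk => ?_
    refine ⟨biprod.lift (k ≫ biprod.fst)
      (hS.exact.lift (k ≫ biprod.snd) (by simpa using hk)), ?_⟩
    have := hS.exact.lift_f (k ≫ biprod.snd) (by simpa using hk)
    dsimp at this ⊢
    ext <;> simp [this]

include hT in
lemma biproduct {n : ℕ} {J : Type*} [Finite J] {F : J → C} [HasBiproductsOfShape J C]
    (h : ∀ j, IsCoresolved T n (F j)) : IsCoresolved T n (⨁ F) := by
  induction n generalizing F with
  | zero =>
    have := hT.finite_sums
    exact T.prop_of_isLimit_fan (biproduct.isLimit F) h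
  | succ n ih =>
    choose Y Z f g w hS hY hZ using h
    have hf (j) : Mono (f j) := (hS j).mono_f
    have hg (j) : Epi (g j) := (hS j).epi_g
    have := hT.finite_sums
    refine ⟨⨁ Y, ⨁ Z, biproduct.map f, biproduct.map g, by ext; simp [w], ?_,
      T.prop_of_isLimit_fan (biproduct.isLimit Y) hY, ih hZ⟩
    have : Mono (biproduct.map f) := ⟨fun a b hab => by
      ext j
      rw [← cancel_mono (f j), Category.assoc, Category.assoc, ← biproduct.map_π,
        reassoc_of% hab]⟩
    have : Epi (biproduct.map g) := ⟨fun a b hab => by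
      ext j
      rw [← cancel_epi (g j), ← biproduct.ι_map_assoc, hab, biproduct.ι_map_assoc]⟩
    refine shortExact_of_lift (S := ShortComplex.mk _ _ _) fun W k hk => ?_
    have hk' (j) : (k ≫ biproduct.π Y j) ≫ g j = 0 := by
      rw [Category.assoc, ← biproduct.map_π, reassoc_of% hk, zero_comp]
    refine ⟨biproduct.lift fun j => (hS j).exact.lift (k ≫ biproduct.π Y j) (hk' j), ?_⟩
    dsimp
    ext j
    have := (hS j).exact.lift_f (k ≫ biproduct.π Y j) (hk' j)
    dsimp at this
    simp [this]

lemma map {D : Type u₂} [Category.{v₂} D] [Abelian D] (F : C ⥤ D)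
    [PreservesFiniteLimits F] [PreservesFiniteColimits F] {T' : ObjectProperty D}
    (hF : ∀ X, T X → T' (F.obj X)) {n : ℕ} {X : C} (h : IsCoresolved T n X) :
    IsCoresolved T' n (F.obj X) := by
  induction n generalizing X with
  | zero => exact hF X h
  | succ n ih =>
    obtain ⟨Y, Z, f, g, w, hS, hY, hZ⟩ := h
    exact ⟨F.obj Y, F.obj Z, F.map f, F.map g, by rw [← F.map_comp, w, F.map_zero],
      hS.map_of_exact F, hF Y hY, ih hZ⟩

/-- Each step of the coresolution shifts the degree up by one, so the induction must treat all `k`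
at once. -/
lemma extVanishes {R : C} (hR : ∀ Y, T Y → ∀ k, ExtVanishes Y R (k + 1)) {n : ℕ} {X : C}
    (h : IsCoresolved T n X) (k : ℕ) : ExtVanishes X R (k + 1) := by
  induction n generalizing X k with
  | zero => exact hR X h k
  | succ n ih =>
    obtain ⟨Y, Z, f, g, w, hS, hY, hZ⟩ := h
    exact ExtVanishes.of_shortExact_left hS (hR Y hY k) (ih hZ (k + 1))

include hT in
/-- The kernel of an epimorphism between objects with a coresolution of length `n` has a
coresolution of length `n + 1`. -/
lemma of_shortExact (hE : ∀ X Y, T X → T Y → ∀ k, ExtVanishes X Y (k + 1)) {n : ℕ} {Y A B : C}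
    {f : Y ⟶ A} {g : A ⟶ B} {w : f ≫ g = 0} (hS : (ShortComplex.mk f g w).ShortExact)
    (hA : IsCoresolved T n A) (hB : IsCoresolved T n B) : IsCoresolved T (n + 1) Y := by
  induction n generalizing Y A B with
  | zero => exact ⟨A, B, f, g, w, hS, hA, hB⟩
  | succ n ih =>
    obtain ⟨S, A', a, a', wa, ha, hTS, hA'⟩ := hA
    obtain ⟨R, B', b, b', wb, hb, hTR, hB'⟩ := hB
    have : Mono f := hS.mono_f
    have : Epi g := hS.epi_g
    have : Mono a := ha.mono_f
    have : Epi a' := ha.epi_g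
    have : Mono b := hb.mono_f
    have : Epi b' := hb.epi_g
    -- Replace `A` by `S` in the given sequence: the pushout `Z` fits into `0 ⟶ Y ⟶ S ⟶ Z ⟶ 0` and
    -- `0 ⟶ B ⟶ Z ⟶ A' ⟶ 0`. It remains to coresolve `Z` in length `n + 1`.
    let Z := pushout a g
    let s : S ⟶ Z := pushout.inl a g
    let i : B ⟶ Z := pushout.inr a g
    have hsi : a ≫ s = g ≫ i := pushout.condition
    let q : Z ⟶ A' := pushout.desc a' 0 (by rw [wa, comp_zero])
    have hsq : s ≫ q = a' := pushout.inl_desc _ _ _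
    have hiq : i ≫ q = 0 := pushout.inr_desc _ _ _
    have hs : Epi s := inferInstanceAs (Epi (pushout.inl a g))
    have hi : Mono i := inferInstanceAs (Mono (pushout.inr a g))
    have hq : Epi q := by
      have : Epi (s ≫ q) := by rwa [hsq]
      exact epi_of_epi s q
    have h₁ : (ShortComplex.mk (f ≫ a) s (by rw [Category.assoc, hsi, reassoc_of% w,
        zero_comp])).ShortExact := by
      have : Mono (f ≫ a) := mono_comp _ _
      refine shortExact_of_desc (S := ShortComplex.mk _ _ _) fun W k hk => ?_
      have hk' : f ≫ a ≫ k = 0 := by simpa using hk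
      exact ⟨pushout.desc k (hS.exact.desc (a ≫ k) hk') (hS.exact.g_desc _ hk').symm,
        pushout.inl_desc _ _ _⟩
    have h₂ : (ShortComplex.mk i q hiq).ShortExact := by
      refine shortExact_of_desc (S := ShortComplex.mk _ _ _) fun W k hk => ?_
      have hk₀ : i ≫ k = 0 := hk
      have hk' : a ≫ s ≫ k = 0 := by rw [reassoc_of% hsi, hk₀, comp_zero]
      refine ⟨ha.exact.desc (s ≫ k) hk', ?_⟩
      have := ha.exact.g_desc (s ≫ k) hk'
      dsimp at this ⊢
      rw [← cancel_epi s, reassoc_of% hsq, this]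
    -- `Ext^1(A', R) = 0`, because `A'` is coresolved by `T` and `R` lies in `T`; hence `b : B ⟶ R`
    -- extends to `Z`.
    obtain ⟨r, hr⟩ := ExtVanishes.exists_extension h₂
      (extVanishes (fun Y hY => hE Y R hY hTR) hA' 0) b
    replace hr : i ≫ r = b := hr
    have hd' : i ≫ r ≫ b' = 0 := by rw [reassoc_of% hr, wb]
    let d : A' ⟶ B' := h₂.exact.desc (r ≫ b') hd'
    have hd : q ≫ d = r ≫ b' := h₂.exact.g_desc (r ≫ b') hd'
    -- `Z` is the kernel of the epimorphism `R ⊞ A' ⟶ B'`, whose source and target have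
    -- coresolutions of length `n`; the induction hypothesis applies to it.
    have h₃ : (ShortComplex.mk (biprod.lift r q) (biprod.desc b' (-d))
        (by rw [biprod.lift_desc, Preadditive.comp_neg, hd, add_neg_cancel])).ShortExact := by
      have : Epi (biprod.desc b' (-d)) := by
        have : Epi (biprod.inl ≫ biprod.desc b' (-d)) := by rwa [biprod.inl_desc]
        exact epi_of_epi biprod.inl _
      have : Mono (biprod.lift r q) := by
        refine Preadditive.mono_of_cancel_zero _ fun {W} x hx => ?_
        have hxr : x ≫ r = 0 := by
          simpa using hx =≫ biprod.fst
        have hxq : x ≫ q = 0 := by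
          simpa using hx =≫ biprod.snd
        let y : W ⟶ B := h₂.exact.lift x hxq
        have hy : y ≫ i = x := h₂.exact.lift_f x hxq
        have : y ≫ b = 0 := by rw [← hr, reassoc_of% hy, hxr]
        rw [← hy, zero_of_comp_mono b this, zero_comp]
      refine shortExact_of_desc (S := ShortComplex.mk _ _ _) fun W k hk => ?_
      replace hk : r ≫ biprod.inl ≫ k + q ≫ biprod.inr ≫ k = 0 := by
        rw [← biprod.lift_desc]
        convert hk
        ext <;> simp
      have hbk : b ≫ biprod.inl ≫ k = 0 := by
        simpa [reassoc_of% hr, reassoc_of% hiq] using i ≫= hk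
      let m : B' ⟶ W := hb.exact.desc (biprod.inl ≫ k) hbk
      have hm : b' ≫ m = biprod.inl ≫ k := hb.exact.g_desc (biprod.inl ≫ k) hbk
      refine ⟨m, ?_⟩
      dsimp
      ext
      · simpa using hm
      · rw [← cancel_epi q, biprod.inr_desc_assoc, Preadditive.neg_comp, Preadditive.comp_neg,
          reassoc_of% hd, hm, eq_comm, ← add_eq_zero_iff_eq_neg, add_comm, hk]
    exact ⟨S, Z, f ≫ a, s, _, h₁, hTS, ih h₃ (biprod_of_mem hT hTR hA') hB'⟩

end IsCoresolved

end Coresolutions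

/-! ### Comparison with long exact sequences -/

section ComposableArrows

variable {C : Type u} [Category.{v} C] [Abelian C] {T : ObjectProperty C}

lemma exact_precomp_precomp_iff {n : ℕ} {X Y : C} (E : ComposableArrows C n) (f : X ⟶ Y)
    (g : Y ⟶ E.left) :
    (ComposableArrows.precomp (E.precomp g) f).Exact ↔
      (∃ w : f ≫ g = 0, (ShortComplex.mk f g w).Exact) ∧ (E.precomp g).Exact := by
  rw [ComposableArrows.exact_iff_δ₀]
  refine and_congr ⟨fun h => ⟨h.toIsComplex.zero 0 le_rfl, h.exact 0 le_rfl⟩, ?_⟩ Iff.rfl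
  rintro ⟨w, h⟩
  exact ComposableArrows.exact₂_mk _ w h

/-- The sequence is cut at the cokernel of `f`, which embeds in the next term. Carrying `Mono f` in
place of the initial zero object keeps the statement stable under this induction. -/
lemma isCoresolved_of_exact (hT : IsAdditivelyClosed T) {n : ℕ} {X : C}
    (E : ComposableArrows C (n + 1)) (f : X ⟶ E.left) (hf : Mono f) (hE : (E.precomp f).Exact)
    (hET : ∀ i : Fin (n + 2), i.val ≤ n → T (E.obj i)) (hlast : IsZero E.right) :
    IsCoresolved T n X := by
  induction n generalizing X with
  | zero =>
    obtain ⟨E, Y, g, rfl⟩ := E.precomp_surjective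
    obtain ⟨⟨w, hfg⟩, -⟩ := (exact_precomp_precomp_iff E f g).1 hE
    have hepi : Epi f := (ShortComplex.exact_iff_epi _ (hlast.eq_of_tgt _ _)).1 hfg
    have := isIso_of_mono_of_epi f
    exact hT.of_iso (asIso f).symm (hET 0 le_rfl)
  | succ n ih =>
    obtain ⟨E, Y, g, rfl⟩ := E.precomp_surjective
    obtain ⟨E, Z, h, rfl⟩ := E.precomp_surjective
    change Y ⟶ Z at g
    change X ⟶ Y at f
    replace hf : Mono f := hf
    obtain ⟨⟨w, hfg⟩, hE⟩ := (exact_precomp_precomp_iff (E.precomp h) f g).1 hE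
    obtain ⟨⟨w', hgh⟩, hE⟩ := (exact_precomp_precomp_iff E g h).1 hE
    let d : cokernel f ⟶ Z := cokernel.desc f g w
    have hd : cokernel.π f ≫ d = g := cokernel.π_desc _ _ _
    have : Mono d := hfg.mono_cokernelDesc
    have w'' : d ≫ h = 0 := by rw [← cancel_epi (cokernel.π f), reassoc_of% hd, w', comp_zero]
    refine ⟨Y, cokernel f, f, cokernel.π f, cokernel.condition f, ?_, hET 0 (by simp), ?_⟩
    · exact ShortComplex.ShortExact.mk' (ShortComplex.cokernelSequence_exact f) hf
        (inferInstanceAs (Epi (cokernel.π f)))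
    · refine ih (E.precomp h) d this ((exact_precomp_precomp_iff E d h).2 ⟨⟨w'', ?_⟩, hE⟩)
        (fun i hi => hET i.succ (by simpa using hi)) hlast
      let φ : ShortComplex.mk g h w' ⟶ ShortComplex.mk d h w'' :=
        { τ₁ := cokernel.π f
          τ₂ := 𝟙 _
          τ₃ := 𝟙 _
          comm₁₂ := by simpa using hd }
      have : Epi φ.τ₁ := inferInstanceAs (Epi (cokernel.π f))
      have : IsIso φ.τ₂ := inferInstanceAs (IsIso (𝟙 _))
      have : Mono φ.τ₃ := inferInstanceAs (Mono (𝟙 _))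
      exact (ShortComplex.exact_iff_of_epi_of_isIso_of_mono φ).1 hgh

/-- The short exact sequences are spliced: `g : Y ⟶ Z` is composed with the embedding `d` of `Z`
into its own coresolution. -/
lemma IsCoresolved.exists_exact {n : ℕ} {X : C} (h : IsCoresolved T n X) :
    ∃ (E : ComposableArrows C (n + 1)) (f : X ⟶ E.left), Mono f ∧ (E.precomp f).Exact ∧
      (∀ i : Fin (n + 2), i.val ≤ n → T (E.obj i)) ∧ IsZero E.right := by
  induction n generalizing X with
  | zero =>
    let Z : ComposableArrows C 0 := ComposableArrows.mk₀ (HasZeroObject.zero' C).zero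
    refine ⟨Z.precomp (0 : X ⟶ Z.left), 𝟙 X,
      inferInstanceAs (Mono (𝟙 X)), ?_, ?_, isZero_zero C⟩
    · refine (exact_precomp_precomp_iff Z (𝟙 X) _).2
        ⟨⟨(isZero_zero C).eq_of_tgt _ _, ?_⟩, ComposableArrows.exact₁ _⟩
      exact (ShortComplex.exact_iff_epi _ (by simp)).2 (inferInstanceAs (Epi (𝟙 X)))
    · intro i hi
      obtain rfl : i = 0 := by ext; simpa using hi
      exact h
  | succ n ih =>
    obtain ⟨Y, Z, f, g, w, hS, hY, hZ⟩ := h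
    obtain ⟨E, d, hd, hE, hET, hlast⟩ := ih hZ
    obtain ⟨E, W, h, rfl⟩ := E.precomp_surjective
    change Z ⟶ W at d
    obtain ⟨⟨w', hdh⟩, hE⟩ := (exact_precomp_precomp_iff E d h).1 hE
    have w₁ : f ≫ g ≫ d = 0 := by rw [reassoc_of% w, zero_comp]
    have w₂ : (g ≫ d) ≫ h = 0 := by rw [Category.assoc, w', comp_zero]
    refine ⟨(E.precomp h).precomp (g ≫ d), f, hS.mono_f, ?_, ?_, hlast⟩
    · refine (exact_precomp_precomp_iff (E.precomp h) f (g ≫ d)).2 ⟨⟨w₁, ?_⟩,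
        (exact_precomp_precomp_iff E (g ≫ d) h).2 ⟨⟨w₂, ?_⟩, hE⟩⟩
      · let φ : ShortComplex.mk f g w ⟶ ShortComplex.mk f (g ≫ d) w₁ :=
          { τ₁ := 𝟙 _
            τ₂ := 𝟙 _
            τ₃ := d }
        have : Epi φ.τ₁ := inferInstanceAs (Epi (𝟙 _))
        have : IsIso φ.τ₂ := inferInstanceAs (IsIso (𝟙 _))
        have : Mono φ.τ₃ := hd
        exact (ShortComplex.exact_iff_of_epi_of_isIso_of_mono φ).1 hS.exact
      · let φ : ShortComplex.mk (g ≫ d) h w₂ ⟶ ShortComplex.mk d h w' :=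
          { τ₁ := g
            τ₂ := 𝟙 _
            τ₃ := 𝟙 _ }
        have : Epi φ.τ₁ := hS.epi_g
        have : IsIso φ.τ₂ := inferInstanceAs (IsIso (𝟙 _))
        have : Mono φ.τ₃ := inferInstanceAs (Mono (𝟙 _))
        exact (ShortComplex.exact_iff_of_epi_of_isIso_of_mono φ).2 hdh
    · intro i hi
      induction i using Fin.cases with
      | zero => exact hY
      | succ i => exact hET i (by simpa using hi)

lemma hasCoresolution_iff (hT : IsAdditivelyClosed T) (n : ℕ) (X : C) :
    HasCoresolution T n X ↔ IsCoresolved T n X := by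
  constructor
  · rintro ⟨E, hE, h₀, ⟨e⟩, hET, hlast⟩
    obtain ⟨E, Z, i, rfl⟩ := E.precomp_surjective
    obtain ⟨E, Y, f, rfl⟩ := E.precomp_surjective
    change Z ⟶ Y at i
    obtain ⟨⟨w, hif⟩, hE⟩ := (exact_precomp_precomp_iff E i f).1 hE
    have : Mono f := (ShortComplex.exact_iff_mono _ (IsZero.eq_of_src h₀ _ _)).1 hif
    exact IsCoresolved.of_iso hT e (isCoresolved_of_exact hT E f this hE
      (fun j hj => hET j.succ.succ (by simp) (by simpa using hj)) hlast)
  · intro h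
    obtain ⟨E, f, hf, hE, hET, hlast⟩ := h.exists_exact
    refine ⟨(E.precomp f).precomp (0 : (HasZeroObject.zero' C).zero ⟶ X),
      (exact_precomp_precomp_iff E _ f).2 ⟨⟨zero_comp, ?_⟩, hE⟩,
      isZero_zero C, ⟨Iso.refl X⟩, ?_, hlast⟩
    · exact (ShortComplex.exact_iff_mono _ rfl).2 hf
    · intro i h₁ h₂
      obtain ⟨j, rfl⟩ : ∃ j : Fin (n + 2), i = j.succ.succ :=
        ⟨⟨i.val - 2, by omega⟩, by ext; simp; omega⟩
      exact hET j (by simpa using h₂)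

end ComposableArrows

lemma isAdditivelyClosed_isProjective (C : Type u) [Category.{v} C] [Abelian C] :
    IsAdditivelyClosed (isProjective C) := by
  refine isAdditivelyClosed_of_sum_eq_id fun J _ X F hF p q h => ⟨fun {E Z} f e _ => ?_⟩
  have hF' (j) : Projective (F j) := hF j
  refine ⟨∑ j, p j ≫ Projective.factorThru (q j ≫ f) e, ?_⟩
  simp only [Preadditive.sum_comp, Category.assoc, Projective.factorThru_comp]
  simp only [← Category.assoc, ← Preadditive.sum_comp, h, Category.id_comp]

/-! ### Exactness of the right adjoint of evaluation; enough projectives -/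

section FiniteCategory

variable {K : Type u₁} [Category.{v₁} K] [∀ a b : K, Finite (a ⟶ b)]
  {A : Type u} [Category.{v} A] [Abelian A]

/-- The projection of a value of `evaluationRightAdjoint` to the factor of index `p`. -/
noncomputable def coevProj (c : K) (M : A) {t : K} (p : t ⟶ c) :
    ((evaluationRightAdjoint A c).obj M).obj t ⟶ M :=
  Pi.π (fun _ : t ⟶ c => M) p

lemma coev_hom_ext {c : K} {M : A} {t : K} {Z : A}
    {f g : Z ⟶ ((evaluationRightAdjoint A c).obj M).obj t}
    (h : ∀ p : t ⟶ c, f ≫ coevProj c M p = g ≫ coevProj c M p) : f = g :=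
  Pi.hom_ext _ _ h

/-- The morphism to a value of `evaluationRightAdjoint` with the given components. -/
noncomputable def coevLift {c : K} {M : A} {t : K} {Z : A} (f : (t ⟶ c) → (Z ⟶ M)) :
    Z ⟶ ((evaluationRightAdjoint A c).obj M).obj t :=
  Pi.lift f

@[simp]
lemma coevLift_proj {c : K} {M : A} {t : K} {Z : A} (f : (t ⟶ c) → (Z ⟶ M)) (p : t ⟶ c) :
    coevLift f ≫ coevProj c M p = f p :=
  Pi.lift_π _ _

@[simp]
lemma coev_map_proj {c : K} (M : A) {s t : K} (f : s ⟶ t) (p : t ⟶ c) :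
    ((evaluationRightAdjoint A c).obj M).map f ≫ coevProj c M p = coevProj c M (f ≫ p) :=
  Pi.lift_π _ _

@[simp]
lemma coev_map_app_proj (c : K) {M N : A} (g : M ⟶ N) {t : K} (p : t ⟶ c) :
    ((evaluationRightAdjoint A c).map g).app t ≫ coevProj c N p = coevProj c M p ≫ g :=
  Pi.lift_π _ _

@[simp]
lemma coev_homEquiv_app_proj (c : K) {X : K ⥤ A} {M : A} (f : X.obj c ⟶ M) {t : K} (p : t ⟶ c) :
    ((evaluationAdjunctionLeft A c).homEquiv X M f).app t ≫ coevProj c M p = X.map p ≫ f := by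
  simp only [evaluationAdjunctionLeft, coevProj, Adjunction.mkOfHomEquiv_homEquiv]
  exact Pi.lift_π _ _

open Classical in
/-- The inclusion of the factor of index `p` into a value of `evaluationRightAdjoint`. -/
noncomputable def coevIncl (c : K) (M : A) {t : K} (p : t ⟶ c) :
    M ⟶ ((evaluationRightAdjoint A c).obj M).obj t :=
  coevLift fun q => if p = q then 𝟙 M else 0

open Classical in
lemma coevIncl_proj (c : K) (M : A) {t : K} (p q : t ⟶ c) :
    coevIncl c M p ≫ coevProj c M q = if p = q then 𝟙 M else 0 :=
  coevLift_proj _ _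

lemma sum_coevProj_incl (c : K) (M : A) (t : K) [Fintype (t ⟶ c)] :
    ∑ p : t ⟶ c, coevProj c M p ≫ coevIncl c M p = 𝟙 _ := by
  classical
  refine coev_hom_ext fun q => ?_
  simp [Preadditive.sum_comp, coevIncl_proj, comp_ite]

instance evaluationRightAdjoint_preservesEpimorphisms (c : K) :
    (evaluationRightAdjoint A c).PreservesEpimorphisms where
  preserves {M N} g _ := by
    have hg (t : K) : Epi (((evaluationRightAdjoint A c).map g).app t) := by
      refine Preadditive.epi_of_cancel_zero _ fun {Z} h hh => ?_
      have := Fintype.ofFinite (t ⟶ c)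
      rw [← Category.id_comp h, ← sum_coevProj_incl, Preadditive.sum_comp]
      refine Finset.sum_eq_zero fun p _ => ?_
      -- The inclusions of the finitely many factors are natural in the object, so an epimorphism
      -- `g` can be cancelled on each factor.
      have hp : g ≫ coevIncl c N p =
          coevIncl c M p ≫ ((evaluationRightAdjoint A c).map g).app t := by
        classical
        refine coev_hom_ext fun q => ?_
        rw [Category.assoc, Category.assoc, coevIncl_proj, coev_map_app_proj, reassoc_of% coevIncl_proj]
        split_ifs <;> simp
      have : coevIncl c N p ≫ h = 0 := by
        rw [← cancel_epi g, reassoc_of% hp, hh, comp_zero, comp_zero]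
      rw [Category.assoc, this, comp_zero]
    exact NatTrans.epi_of_epi_app _

instance evaluationRightAdjoint_preservesFiniteLimits (c : K) :
    PreservesFiniteLimits (evaluationRightAdjoint A c) :=
  have := (evaluationAdjunctionLeft A c).rightAdjoint_preservesLimits
  ⟨fun _ => inferInstance⟩

instance evaluationRightAdjoint_additive (c : K) : (evaluationRightAdjoint A c).Additive :=
  Functor.additive_of_preserves_binary_products _

instance evaluationRightAdjoint_preservesFiniteColimits (c : K) :
    PreservesFiniteColimits (evaluationRightAdjoint A c) := by
  rw [Functor.preservesFiniteColimits_iff_forall_exact_map_and_epi]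
  intro S hS
  have := hS.epi_g
  exact ⟨(((Functor.preservesFiniteLimits_iff_forall_exact_map_and_mono _).1 inferInstance) S hS).1,
    inferInstance⟩

instance evaluation_preservesProjectiveObjects (c : K) :
    ((evaluation K A).obj c).PreservesProjectiveObjects :=
  Functor.preservesProjectiveObjects_of_adjunction_of_preservesEpimorphisms
    (evaluationAdjunctionLeft A c)

/-- The left adjoint of evaluation at `c` sends projectives to projectives. The sum over all `c` of
its values at projective covers of the `X.obj c`, in the weak sense of epimorphisms from
projectives, maps onto `X`. -/
lemma enoughProjectives_functor [Finite K] [EnoughProjectives A] :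
    EnoughProjectives (K ⥤ A) where
  presentation X := by
    have : HasFiniteBiproducts (K ⥤ A) := Abelian.hasFiniteBiproducts
    have := Fintype.ofFinite K
    let adj (c : K) := evaluationAdjunctionRight A c
    let P (c : K) : K ⥤ A := (evaluationLeftAdjoint A c).obj (Projective.over (X.obj c))
    have hP (c : K) : Projective (P c) := (adj c).map_projective _ inferInstance
    let f (c : K) : P c ⟶ X := ((adj c).homEquiv _ _).symm (Projective.π (X.obj c))
    have : Projective (⨁ P) := (isAdditivelyClosed_isProjective (K ⥤ A)).of_sum_eq_id P hP _ _
      (IsBilimit.total (biproduct.isBilimit P))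
    have hf (c : K) : Epi ((biproduct.desc f).app c) := by
      have h : ((adj c).unit.app (Projective.over (X.obj c)) ≫ (biproduct.ι P c).app c) ≫
          (biproduct.desc f).app c = Projective.π (X.obj c) := by
        rw [Category.assoc, ← NatTrans.comp_app, biproduct.ι_desc]
        exact ((adj c).homEquiv _ _).apply_symm_apply (Projective.π (X.obj c))
      exact epi_of_epi_fac h
    exact ⟨{ p := ⨁ P, f := biproduct.desc f, epi := NatTrans.epi_of_epi_app _ }⟩

end FiniteCategory

/-! ### Right approximations -/

section Approximation

variable {K : Type u₁} [Category.{v₁} K] [∀ a b : K, Finite (a ⟶ b)]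
  {A : Type u} [Category.{v} A] [Abelian A]

/-- Morphisms from the objects `(evaluationRightAdjoint A c).obj M` to a fixed functor `X` factor
through a universal one. -/
lemma exists_coev_counit [Finite K] (c : K) (X : K ⥤ A) :
    ∃ (G : A) (ε : (evaluationRightAdjoint A c).obj G ⟶ X), ∀ (M : A)
      (f : (evaluationRightAdjoint A c).obj M ⟶ X),
      ∃ g : M ⟶ G, (evaluationRightAdjoint A c).map g ≫ ε = f := by
  classical
  have : HasFiniteBiproducts A := Abelian.hasFiniteBiproducts
  have hK := Fintype.ofFinite K
  have hKhom (a b : K) := Fintype.ofFinite (a ⟶ b)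
  let V : (Σ j : K, (j ⟶ c)) → A := fun x => X.obj x.1
  let W : (Σ j : K, Σ k : K, (j ⟶ c) × (j ⟶ k)) → A := fun x => X.obj x.2.1
  -- A transformation from `(evaluationRightAdjoint A c).obj M` to `X` is given by its restrictions
  -- `w_p : M ⟶ X_j` to the factors `p : j ⟶ c`. Naturality along `a : j ⟶ k` says that `w_p`
  -- followed by `X.map a` is the sum of the `w_q` with `a ≫ q = p`. The kernel of `D` represents
  -- such families.
  let D : ⨁ V ⟶ ⨁ W := biproduct.lift fun x =>
    biproduct.π V ⟨x.1, x.2.2.1⟩ ≫ X.map x.2.2.2 -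
      ∑ q : x.2.1 ⟶ c, if x.2.2.2 ≫ q = x.2.2.1 then biproduct.π V ⟨x.2.1, q⟩ else 0
  let w (j : K) (p : j ⟶ c) : kernel D ⟶ X.obj j := kernel.ι D ≫ biproduct.π V ⟨j, p⟩
  have hw (j k : K) (p : j ⟶ c) (a : j ⟶ k) :
      w j p ≫ X.map a = ∑ q : k ⟶ c, if a ≫ q = p then w k q else 0 := by
    have h := kernel.condition D =≫ biproduct.π W ⟨j, k, p, a⟩
    rw [Category.assoc, biproduct.lift_π, zero_comp, Preadditive.comp_sub, sub_eq_zero,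
      Preadditive.comp_sum] at h
    rw [Category.assoc, h]
    refine Finset.sum_congr rfl fun q _ => ?_
    split_ifs <;> simp [w]
  let ε : (evaluationRightAdjoint A c).obj (kernel D) ⟶ X :=
    { app := fun j => ∑ p : j ⟶ c, coevProj c (kernel D) p ≫ w j p
      naturality := fun j k a => by
        simp only [Preadditive.comp_sum, Preadditive.sum_comp, Category.assoc, hw,
          reassoc_of% coev_map_proj]
        rw [Finset.sum_comm]
        refine Finset.sum_congr rfl fun q _ => ?_
        simp [comp_ite] }
  refine ⟨kernel D, ε, fun M f => ?_⟩
  let g₀ : M ⟶ ⨁ V := biproduct.lift fun x => coevIncl c M x.2 ≫ f.app x.1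
  have hincl (j k : K) (p : j ⟶ c) (a : j ⟶ k) :
      coevIncl c M p ≫ ((evaluationRightAdjoint A c).obj M).map a =
        ∑ q : k ⟶ c, if a ≫ q = p then coevIncl c M q else 0 := by
    refine coev_hom_ext fun q => ?_
    rw [Category.assoc, coev_map_proj, coevIncl_proj, Preadditive.sum_comp]
    simp only [ite_comp, coevIncl_proj, zero_comp]
    rw [Finset.sum_eq_single q (by aesop) (by simp)]
    simp [eq_comm]
  have hg₀ : g₀ ≫ D = 0 := by
    refine biproduct.hom_ext _ _ fun ⟨j, k, p, a⟩ => ?_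
    rw [Category.assoc, biproduct.lift_π, zero_comp, Preadditive.comp_sub, sub_eq_zero,
      biproduct.lift_π_assoc, Category.assoc, ← f.naturality, reassoc_of% hincl,
      Preadditive.comp_sum, Preadditive.sum_comp]
    refine Finset.sum_congr rfl fun q _ => ?_
    dsimp only
    split_ifs <;> simp [g₀]
  refine ⟨kernel.lift D g₀ hg₀, ?_⟩
  ext j
  have h (p : j ⟶ c) : kernel.lift D g₀ hg₀ ≫ w j p = coevIncl c M p ≫ f.app j := by
    rw [kernel.lift_ι_assoc, biproduct.lift_π]
  rw [NatTrans.comp_app, Preadditive.comp_sum]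
  simp only [reassoc_of% coev_map_app_proj c, h]
  conv_rhs => rw [← Category.id_comp (f.app j), ← sum_coevProj_incl, Preadditive.sum_comp]
  simp only [Category.assoc]

/-- A map from `e_c^ρ(N)` to `X` comes from a map `N ⟶ G c`, which factors through a
`T`-approximation of `G c`. As there are finitely many `c`, one direct sum serves them all. -/
lemma isContravariantlyFinite_coev [Finite K] {T : ObjectProperty A}
    (hT : IsContravariantlyFinite T) :
    IsContravariantlyFinite
      (addClosure fun X : K ⥤ A => ∃ c M, T M ∧ X = (evaluationRightAdjoint A c).obj M) := by
  intro X
  have : HasFiniteBiproducts (K ⥤ A) := Abelian.hasFiniteBiproducts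
  have := Fintype.ofFinite K
  choose G ε hε using fun c => exists_coev_counit c X
  choose M φ hM hφ using fun c => hT (G c)
  let P (c : K) := (evaluationRightAdjoint A c).obj (M c)
  let Φ : ⨁ P ⟶ X := biproduct.desc fun c => (evaluationRightAdjoint A c).map (φ c) ≫ ε c
  refine ⟨⨁ P, Φ, addClosure_of_sum_eq_id P (fun c => ⟨c, _, hM c, rfl⟩) _ _
    (IsBilimit.total (biproduct.isBilimit P)), fun X' hX' g => ?_⟩
  obtain ⟨k, F, p, q, hF, hpq⟩ := hX'.exists_sum_eq_id
  have key (j : Fin k) : ∃ h : F j ⟶ ⨁ P, h ≫ Φ = q j ≫ g := by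
    obtain ⟨c, N, hN, hFj⟩ := hF j
    generalize q j ≫ g = f
    generalize F j = Y at hFj f
    subst hFj
    obtain ⟨g₁, rfl⟩ := hε c N f
    obtain ⟨g₂, rfl⟩ := hφ c N hN g₁
    exact ⟨(evaluationRightAdjoint A c).map g₂ ≫ biproduct.ι P c, by simp [Φ]⟩
  choose h hh using key
  refine ⟨∑ j, p j ≫ h j, ?_⟩
  simp only [Preadditive.sum_comp, Category.assoc, hh]
  simp only [← Category.assoc, ← Preadditive.sum_comp, hpq, Category.id_comp]

end Approximation

lemma extVanishes_coev {K : Type u₁} [Category.{v₁} K] [∀ a b : K, Finite (a ⟶ b)] {A : Type u}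
    [Category.{v} A] [Abelian A] [EnoughProjectives (K ⥤ A)] {c : K} {M : A} {X : K ⥤ A} {k : ℕ}
    (h : ExtVanishes (X.obj c) M (k + 1)) :
    ExtVanishes X ((evaluationRightAdjoint A c).obj M) (k + 1) :=
  ExtVanishes.of_adjunction (evaluationAdjunctionLeft A c) k X h

/-! ### Finite sums of coinduced functors, in components -/

section Cofree

variable {K : Type u₁} [Category.{v₁} K] [∀ a b : K, Finite (a ⟶ b)]
  {A : Type u} [Category.{v} A] [Abelian A]

instance hasBiproductsOfShape_functor (I : Type*) [Finite I] :
    HasBiproductsOfShape I (K ⥤ A) :=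
  have : HasFiniteBiproducts (K ⥤ A) := Abelian.hasFiniteBiproducts
  inferInstance

variable {I : Type*} [Finite I] (c : I → K) (M : I → A)

/-- The direct sum of the functors `(evaluationRightAdjoint A (c x)).obj (M x)`. -/
noncomputable def cofree : K ⥤ A :=
  ⨁ fun x => (evaluationRightAdjoint A (c x)).obj (M x)

/-- The projection of `cofree c M` to a summand. -/
noncomputable def cofreeπ (x : I) : cofree c M ⟶ (evaluationRightAdjoint A (c x)).obj (M x) :=
  biproduct.π (fun x => (evaluationRightAdjoint A (c x)).obj (M x)) x

/-- The inclusion of a summand of `cofree c M`. -/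
noncomputable def cofreeι (x : I) : (evaluationRightAdjoint A (c x)).obj (M x) ⟶ cofree c M :=
  biproduct.ι (fun x => (evaluationRightAdjoint A (c x)).obj (M x)) x

lemma cofree_total [Fintype I] : ∑ x, cofreeπ c M x ≫ cofreeι c M x = 𝟙 (cofree c M) :=
  IsBilimit.total (biproduct.isBilimit _)

/-- The component of a value of `cofree c M` belonging to an index `x` and a morphism to `c x`. -/
noncomputable def cofreeProj {t : K} (x : I) (p : t ⟶ c x) : (cofree c M).obj t ⟶ M x :=
  (cofreeπ c M x).app t ≫ coevProj (c x) (M x) p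

variable {c M}

@[simp]
lemma cofree_map_proj {s t : K} (f : s ⟶ t) (x : I) (p : t ⟶ c x) :
    (cofree c M).map f ≫ cofreeProj c M x p = cofreeProj c M x (f ≫ p) := by
  rw [cofreeProj, cofreeProj, ← coev_map_proj, NatTrans.naturality_assoc]

lemma cofree_hom_ext {t : K} {Z : A} {f g : Z ⟶ (cofree c M).obj t}
    (h : ∀ x p, f ≫ cofreeProj c M x p = g ≫ cofreeProj c M x p) : f = g := by
  have := Fintype.ofFinite I
  have total : ∑ x, (cofreeπ c M x).app t ≫ (cofreeι c M x).app t = 𝟙 ((cofree c M).obj t) := by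
    have := congr_arg (fun φ => φ.app t) (cofree_total c M)
    simpa only [NatTrans.app_sum, NatTrans.comp_app, NatTrans.id_app] using this
  rw [← Category.comp_id f, ← Category.comp_id g, ← total, Preadditive.comp_sum,
    Preadditive.comp_sum]
  refine Finset.sum_congr rfl fun x _ => ?_
  rw [← Category.assoc, ← Category.assoc]
  congr 1
  refine coev_hom_ext fun p => ?_
  rw [Category.assoc, Category.assoc]
  exact h x p

lemma cofreeι_π_self (x : I) : cofreeι c M x ≫ cofreeπ c M x = 𝟙 _ :=
  biproduct.ι_π_self _ x

lemma cofreeι_π_ne {x y : I} (h : x ≠ y) : cofreeι c M x ≫ cofreeπ c M y = 0 :=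
  biproduct.ι_π_ne _ h

lemma exists_cofree_lift {t : K} {Z : A} (f : ∀ x, (t ⟶ c x) → (Z ⟶ M x)) :
    ∃ g : Z ⟶ (cofree c M).obj t, ∀ x p, g ≫ cofreeProj c M x p = f x p := by
  have := Fintype.ofFinite I
  refine ⟨∑ x, coevLift (f x) ≫ (cofreeι c M x).app t, fun x p => ?_⟩
  rw [Preadditive.sum_comp, Finset.sum_eq_single x]
  · rw [Category.assoc, cofreeProj, ← NatTrans.comp_app_assoc, cofreeι_π_self,
      NatTrans.id_app, Category.id_comp, coevLift_proj]
  · intro y _ hy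
    rw [Category.assoc, cofreeProj, ← NatTrans.comp_app_assoc, cofreeι_π_ne hy]
    simp
  · simp

/-- The morphism to `cofree c M` with given components. -/
noncomputable def toCofree {X : K ⥤ A} (f : ∀ x, X.obj (c x) ⟶ M x) : X ⟶ cofree c M :=
  biproduct.lift fun x => (evaluationAdjunctionLeft A (c x)).homEquiv X (M x) (f x)

lemma toCofree_π {X : K ⥤ A} (f : ∀ x, X.obj (c x) ⟶ M x) (x : I) :
    toCofree f ≫ cofreeπ c M x = (evaluationAdjunctionLeft A (c x)).homEquiv X (M x) (f x) :=
  biproduct.lift_π _ _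

@[simp]
lemma toCofree_app_proj {X : K ⥤ A} (f : ∀ x, X.obj (c x) ⟶ M x) {t : K} (x : I)
    (p : t ⟶ c x) : (toCofree f).app t ≫ cofreeProj c M x p = X.map p ≫ f x := by
  rw [cofreeProj, ← NatTrans.comp_app_assoc, toCofree_π, coev_homEquiv_app_proj]

lemma extVanishes_cofree [EnoughProjectives (K ⥤ A)] {X : K ⥤ A} {k : ℕ}
    (h : ∀ x, ExtVanishes (X.obj (c x)) (M x) (k + 1)) : ExtVanishes X (cofree c M) (k + 1) := by
  have := Fintype.ofFinite I
  exact ExtVanishes.of_sum_eq_id _ (fun x => extVanishes_coev (h x)) _ _ (cofree_total c M)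

lemma isCoresolved_cofree {T : ObjectProperty A} {T' : ObjectProperty (K ⥤ A)}
    (hT' : IsAdditivelyClosed T')
    (h : ∀ c X, T X → T' ((evaluationRightAdjoint A c).obj X)) {n : ℕ}
    (hM : ∀ x, IsCoresolved T n (M x)) : IsCoresolved T' n (cofree c M) :=
  IsCoresolved.biproduct hT' fun x => (hM x).map (evaluationRightAdjoint A (c x)) (h (c x))

end Cofree

/-! ### Recursion along paths -/

section Recursion

variable {Q : Type u₁} [Quiver.{v₁} Q] {A : Type u} [Category.{v} A] [Abelian A]

/-- The type of arrows of a quiver. -/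
abbrev Arrows (Q : Type u₁) [Quiver.{v₁} Q] := Σ (i j : Q), i ⟶ j

/-- The source of an arrow. -/
def Arrows.src (a : Arrows Q) : Paths Q := a.1

/-- The target of an arrow. -/
def Arrows.tgt (a : Arrows Q) : Paths Q := a.2.1

/-- An arrow, as a morphism of the path category. -/
def Arrows.hom (a : Arrows Q) : a.src ⟶ a.tgt := (Paths.of Q).map a.2.2

lemma paths_induction {t : Paths Q} {P : ∀ i : Paths Q, (t ⟶ i) → Prop} (nil : P t (𝟙 t))
    (cons : ∀ (a : Arrows Q) (p : t ⟶ a.src), P a.src p → P a.tgt (p ≫ a.hom)) (i : Paths Q)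
    (p : t ⟶ i) : P i p :=
  @Quiver.Path.rec Q _ t (fun i p => P i p) nil (fun p a hp => cons ⟨_, _, a⟩ p hp) i p

/-- A nontrivial path has a unique last arrow, so the values may be prescribed one arrow at a time;
this is where freeness of the path category enters. -/
lemma exists_path_recursion {t : Paths Q} (Y : Paths Q ⥤ A) {Z : A}
    (z : ∀ a : Arrows Q, (t ⟶ a.src) → (Z ⟶ Y.obj a.tgt)) :
    ∃ h : ∀ i : Paths Q, (t ⟶ i) → (Z ⟶ Y.obj i), h t (𝟙 t) = 0 ∧
      ∀ (a : Arrows Q) (p : t ⟶ a.src),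
        h a.tgt (p ≫ a.hom) = h a.src p ≫ Y.map a.hom - z a p :=
  ⟨fun i p => @Quiver.Path.rec Q _ t (fun i _ => Z ⟶ Y.obj i) 0
    (fun {b c} p a hp => hp ≫ Y.map (Arrows.hom ⟨b, c, a⟩) - z ⟨b, c, a⟩ p) i p,
    rfl, fun _ _ => rfl⟩

end Recursion

/-! ### The standard coresolution of a representation -/

section Paths

variable {Q : Type u₁} [Quiver.{v₁} Q] [Finite Q] [∀ i j : Q, Finite (i ⟶ j)] [IsAcyclicQuiver Q]
  {A : Type u} [Category.{v} A] [Abelian A]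

instance finite_hom_paths (i j : Paths Q) : Finite (i ⟶ j) := finite_path Q i j

instance finite_paths : Finite (Paths Q) := inferInstanceAs (Finite Q)

/-- The direct sum of the representations `e_i^ρ(Y_i)`. -/
noncomputable abbrev vertexCofree (Y : Paths Q ⥤ A) : Paths Q ⥤ A :=
  cofree (fun i : Paths Q => i) fun i => Y.obj i

/-- The direct sum, over all arrows `i ⟶ j`, of the representations `e_i^ρ(Y_j)`. -/
noncomputable abbrev arrowCofree (Y : Paths Q ⥤ A) : Paths Q ⥤ A :=
  cofree Arrows.src fun a => Y.obj a.tgt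

/-- The embedding of a representation into a direct sum of representations `e_i^ρ(Y_i)`. -/
noncomputable def toVertexCofree (Y : Paths Q ⥤ A) : Y ⟶ vertexCofree Y :=
  toCofree fun _ => 𝟙 _

/-- The components of a value of `vertexCofree`. -/
noncomputable abbrev vertexProj (Y : Paths Q ⥤ A) {t : Paths Q} (i : Paths Q) (p : t ⟶ i) :
    (vertexCofree Y).obj t ⟶ Y.obj i :=
  cofreeProj (fun i : Paths Q => i) (fun i => Y.obj i) i p

/-- The components of a value of `arrowCofree`. -/
noncomputable abbrev arrowProj (Y : Paths Q ⥤ A) {t : Paths Q} (a : Arrows Q) (p : t ⟶ a.src) :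
    (arrowCofree Y).obj t ⟶ Y.obj a.tgt :=
  cofreeProj Arrows.src (fun a => Y.obj a.tgt) a p

/-- The morphism whose component at an arrow `a : i ⟶ j` measures the failure of a family of
elements of the `Y_i` to be compatible with `a`. -/
noncomputable def vertexToArrow (Y : Paths Q ⥤ A) : vertexCofree Y ⟶ arrowCofree Y :=
  toCofree fun a => vertexProj Y a.src (𝟙 a.src) ≫ Y.map a.hom - vertexProj Y a.tgt a.hom

@[simp]
lemma toVertexCofree_app_proj (Y : Paths Q ⥤ A) {t : Paths Q} (i : Paths Q) (p : t ⟶ i) :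
    (toVertexCofree Y).app t ≫ vertexProj Y i p = Y.map p :=
  (toCofree_app_proj _ _ _).trans (Category.comp_id _)

@[simp]
lemma vertexToArrow_app_proj (Y : Paths Q ⥤ A) {t : Paths Q} (a : Arrows Q) (p : t ⟶ a.src) :
    (vertexToArrow Y).app t ≫ arrowProj Y a p =
      vertexProj Y a.src p ≫ Y.map a.hom - vertexProj Y a.tgt (p ≫ a.hom) := by
  refine (toCofree_app_proj _ _ _).trans ?_
  rw [Preadditive.comp_sub, reassoc_of% cofree_map_proj, cofree_map_proj, Category.comp_id]

lemma toVertexCofree_vertexToArrow (Y : Paths Q ⥤ A) :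
    toVertexCofree Y ≫ vertexToArrow Y = 0 := by
  ext t
  refine cofree_hom_ext fun a p => ?_
  rw [NatTrans.comp_app, Category.assoc, vertexToArrow_app_proj, Preadditive.comp_sub,
    reassoc_of% toVertexCofree_app_proj, toVertexCofree_app_proj, Y.map_comp, sub_self]
  simp

/-- At a fixed vertex the three-term complex is contractible: the component at the trivial path
retracts the embedding, and `s` splits the second map. The contraction need not be natural in `t`.
-/
lemma exists_vertexToArrow_section (Y : Paths Q ⥤ A) (t : Paths Q) :
    ∃ s : (arrowCofree Y).obj t ⟶ (vertexCofree Y).obj t,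
      s ≫ (vertexToArrow Y).app t = 𝟙 _ ∧
      vertexProj Y t (𝟙 t) ≫ (toVertexCofree Y).app t + (vertexToArrow Y).app t ≫ s = 𝟙 _ := by
  -- Solve `h(p) ≫ Y.map a - h(p ≫ a) = z(a, p)` for `h`, normalized to `0` on the trivial path so
  -- that `s` is complementary to the retraction.
  obtain ⟨h, hnil, hcons⟩ := exists_path_recursion Y fun a p => arrowProj Y (t := t) a p
  obtain ⟨s, hs⟩ := exists_cofree_lift h
  refine ⟨s, cofree_hom_ext fun a p => ?_, cofree_hom_ext fun i p => ?_⟩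
  · rw [Category.assoc, vertexToArrow_app_proj, Preadditive.comp_sub, reassoc_of% hs, hs, hcons]
    simp
  · rw [Preadditive.add_comp, Category.assoc, Category.assoc, toVertexCofree_app_proj, hs,
      Category.id_comp]
    induction i, p using paths_induction with
    | nil => simp [hnil]
    | cons a p ih =>
      rw [hcons, Preadditive.comp_sub, vertexToArrow_app_proj, Y.map_comp, ← Category.assoc,
        ← Category.assoc, ← add_sub_assoc, ← Preadditive.add_comp, ih]
      abel

/-- Every representation `Y` has the coresolution
`0 ⟶ Y ⟶ ⨁ e_i^ρ(Y_i) ⟶ ⨁ e_i^ρ(Y_j) ⟶ 0`, where the sums are over the vertices `i` and over the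
arrows `i ⟶ j`. -/
lemma shortExact_cofree (Y : Paths Q ⥤ A) :
    (ShortComplex.mk _ _ (toVertexCofree_vertexToArrow Y)).ShortExact := by
  have hmono (t : Paths Q) : Mono ((toVertexCofree Y).app t) := by
    have h := (toVertexCofree_app_proj Y t (𝟙 t)).trans (Y.map_id t)
    exact mono_of_mono_fac h
  have hepi (t : Paths Q) : Epi ((vertexToArrow Y).app t) := by
    obtain ⟨s, hs, -⟩ := exists_vertexToArrow_section Y t
    exact epi_of_epi_fac hs
  have : Mono (toVertexCofree Y) := NatTrans.mono_of_mono_app _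
  have : Epi (vertexToArrow Y) := NatTrans.epi_of_epi_app _
  refine shortExact_of_lift (S := ShortComplex.mk _ _ _) fun W k hk => ?_
  change W ⟶ vertexCofree Y at k
  replace hk : k ≫ vertexToArrow Y = 0 := hk
  have hk' (t : Paths Q) :
      (k.app t ≫ vertexProj Y t (𝟙 t)) ≫ (toVertexCofree Y).app t = k.app t := by
    obtain ⟨s, -, hs⟩ := exists_vertexToArrow_section Y t
    have h₀ : k.app t ≫ (vertexToArrow Y).app t = 0 := by rw [← NatTrans.comp_app, hk]; rfl
    have := k.app t ≫= hs
    rwa [Preadditive.comp_add, reassoc_of% h₀, zero_comp, add_zero, Category.comp_id,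
      ← Category.assoc] at this
  refine ⟨{ app := fun t => k.app t ≫ vertexProj Y t (𝟙 t)
            naturality := fun t t' f => ?_ }, ?_⟩
  · have h : (k.app t ≫ vertexProj Y t (𝟙 t)) ≫ Y.map f ≫ (toVertexCofree Y).app t' =
        k.app t ≫ (vertexCofree Y).map f := by
      rw [(toVertexCofree Y).naturality, ← Category.assoc, hk']
    rw [← cancel_mono ((toVertexCofree Y).app t'), Category.assoc, hk', NatTrans.naturality,
      Category.assoc, ← h]
  · ext t
    exact hk' t

end Paths

/-! ### The tilting property -/

lemma IsTilting.extVanishes {C : Type u} [Category.{v} C] [Abelian C] {n : ℕ}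
    {T : ObjectProperty C} (hT : IsTilting n T) (X Y : C) (hX : T X) (hY : T Y) (k : ℕ) :
    ExtVanishes X Y (k + 1) :=
  hT.ext_vanishing X Y hX hY (k + 1) (by omega)

/-- Projective dimension at most `0` makes `T` consist of projectives, and `0 ⟶ P ⟶ T⁰ ⟶ 0` puts
every projective in `T`. Conversely, an epimorphism from a projective is a right approximation. -/
lemma isTilting_zero_iff {A : Type u} [Category.{v} A] [Abelian A] [EnoughProjectives A]
    (T : ObjectProperty A) : IsTilting 0 T ↔ T = isProjective A := by
  constructor
  · intro hT
    ext X
    refine ⟨fun hX => ?_, fun hX => ?_⟩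
    · have := hT.projective_dimension X hX
      exact projective_iff_hasProjectiveDimensionLT_one.2 this
    · exact (hasCoresolution_iff hT.additively_closed 0 X).1 (hT.coresolution X hX)
  · rintro rfl
    refine ⟨isAdditivelyClosed_isProjective A, fun X => ?_, fun X Y hX _ k hk => ?_, fun X hX => ?_,
      fun P hP => (hasCoresolution_iff (isAdditivelyClosed_isProjective A) 0 P).2 hP⟩
    · refine ⟨Projective.over X, Projective.π X, Projective.projective_over X, fun P hP g => ?_⟩
      have : Projective P := hP
      exact ⟨Projective.factorThru g (Projective.π X), Projective.factorThru_comp _ _⟩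
    · obtain ⟨k, rfl⟩ : ∃ j, k = j + 1 := ⟨k - 1, by omega⟩
      have : Projective X := hX
      exact extVanishes_of_projective X Y k
    · have : Projective X := hX
      exact inferInstanceAs (HasProjectiveDimensionLT X 1)

lemma addClosure_eRhoObjects_obj {A : Type u} [Category.{v} A] [Abelian A]
    {Q : Type u₁} [Quiver.{v₁} Q] [Finite Q] [∀ i j : Q, Finite (i ⟶ j)] [IsAcyclicQuiver Q]
    {T : ObjectProperty A} (hT : IsAdditivelyClosed T)
    {X : QuiverRep Q A} (hX : addClosure (eRhoObjects Q A T) X) (i : Paths Q) : T (X.obj i) := by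
  obtain ⟨k, F, p, q, hF, hpq⟩ := hX.exists_sum_eq_id
  refine hT.of_sum_eq_id (fun j => (F j).obj i) (fun j => ?_) (fun j => (p j).app i)
    (fun j => (q j).app i) ?_
  · obtain ⟨c, M, hM, hFj⟩ := hF j
    have := Fintype.ofFinite (i ⟶ (show Paths Q from c))
    have h : T (((evaluationRightAdjoint A (show Paths Q from c)).obj M).obj i) :=
      hT.of_sum_eq_id (fun _ => M) (fun _ => hM) _ _ (sum_coevProj_incl _ M i)
    rw [hFj]
    exact h
  · have := congr_arg (fun φ => φ.app i) hpq
    simpa only [NatTrans.app_sum, NatTrans.comp_app, NatTrans.id_app] using this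

section Main

variable {A : Type u} [Category.{v} A] [Abelian A] [EnoughProjectives A]
  {Q : Type u₁} [Quiver.{v₁} Q] [Finite Q] [∀ i j : Q, Finite (i ⟶ j)] [IsAcyclicQuiver Q]

instance enoughProjectives_quiverRep : EnoughProjectives (QuiverRep Q A) :=
  enoughProjectives_functor

/-- In the standard coresolution of `Y`, `Ext^(k+1)(X, Y)` lies between `Ext^k` into the arrow term
and `Ext^(k+1)` into the vertex term. Both vanish for `k ≥ n + 1` by the bound on the values of `X`.
-/
lemma hasProjectiveDimensionLE_quiverRep (X : QuiverRep Q A) (n : ℕ)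
    (h : ∀ i : Paths Q, HasProjectiveDimensionLE (X.obj i) n) :
    HasProjectiveDimensionLE X (n + 1) := by
  simp only [hasProjectiveDimensionLE_iff_extVanishes] at h ⊢
  intro k Y hk
  obtain ⟨k, rfl⟩ : ∃ j, k = j + 1 := ⟨k - 1, by omega⟩
  exact ExtVanishes.of_shortExact_right (shortExact_cofree Y)
    (extVanishes_cofree fun i => h _ _ _ (by omega)) (extVanishes_cofree fun a => h _ _ _ (by omega))

lemma isTilting_addClosure_eRhoObjects {n : ℕ} {T : ObjectProperty A} (hT : IsTilting n T) :
    IsTilting (n + 1) (addClosure (eRhoObjects Q A T)) := by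
  have hadd := isAdditivelyClosed_addClosure (eRhoObjects Q A T)
  have hmem (c : Paths Q) (M : A) (hM : T M) :
      addClosure (eRhoObjects Q A T) ((evaluationRightAdjoint A c).obj M) :=
    addClosure_of_mem ⟨c, M, hM, rfl⟩
  have hext (X Y : QuiverRep Q A) (hX : addClosure (eRhoObjects Q A T) X)
      (hY : addClosure (eRhoObjects Q A T) Y) (k : ℕ) : ExtVanishes X Y (k + 1) := by
    obtain ⟨m, F, p, q, hF, hpq⟩ := hY.exists_sum_eq_id
    refine ExtVanishes.of_sum_eq_id F (fun j => ?_) p q hpq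
    obtain ⟨c, M, hM, hFj⟩ := hF j
    rw [hFj]
    exact extVanishes_coev (K := Paths Q) (c := c)
      (hT.extVanishes _ _ (addClosure_eRhoObjects_obj hT.additively_closed hX c) hM k)
  refine ⟨hadd, isContravariantlyFinite_coev hT.contravariantly_finite, ?_, ?_, ?_⟩
  · intro X Y hX hY k hk
    obtain ⟨k, rfl⟩ : ∃ j, k = j + 1 := ⟨k - 1, by omega⟩
    exact hext X Y hX hY k
  · intro X hX
    exact hasProjectiveDimensionLE_quiverRep X n fun i =>
      hT.projective_dimension _ (addClosure_eRhoObjects_obj hT.additively_closed hX i)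
  · intro P hP
    rw [hasCoresolution_iff hadd]
    have hcores (i : Paths Q) : IsCoresolved T n (P.obj i) :=
      (hasCoresolution_iff hT.additively_closed n _).1 (hT.coresolution _
        (((evaluation (Paths Q) A).obj i).projective_obj_of_projective hP))
    exact IsCoresolved.of_shortExact hadd hext (shortExact_cofree P)
      (isCoresolved_cofree hadd hmem fun i => hcores i)
      (isCoresolved_cofree hadd hmem fun a => hcores a.tgt)

end Main

end QuiverTilting

open QuiverTilting
theorem mainTheorem4
    {A : Type u} [Category.{v} A] [Abelian A] [EnoughProjectives A]
    {Q : Type u₁} [Quiver.{v₁} Q] [Finite Q] [∀ i j : Q, Finite (i ⟶ j)] [IsAcyclicQuiver Q] :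
    EnoughProjectives (QuiverRep Q A) ∧
    (∀ (n : ℕ) (T : ObjectProperty A), IsTilting n T →
      IsTilting (n + 1) (addClosure (eRhoObjects Q A T))) ∧
    (∀ T : ObjectProperty A, IsTilting 0 T ↔ T = isProjective A) ∧
    IsTilting 1 (addClosure (eRhoObjects Q A (isProjective A))) :=
  ⟨inferInstance, fun _ _ hT => isTilting_addClosure_eRhoObjects hT, isTilting_zero_iff,
    isTilting_addClosure_eRhoObjects ((isTilting_zero_iff _).2 rfl)⟩
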